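/- Let $\mathcal H$ be a complex Hilbert space, $\mathcal B(\mathcal H)$ the bounded linear operators on $\mathcal H$, and $\mathcal S_2(\mathcal H)$ the space of Hilbert--Schmidt operators on $\mathcal H$ with the norm $\|A\|_2=\operatorname{Tr}(A^*A)^{1/2}$. Let $\rho$ be a positive trace-class operator on $\mathcal H$ such that the functional $\omega_\rho(x)=\operatorname{Tr}(\rho x)$ on $\mathcal B(\mathcal H)$ is faithful, i.e. $\omega_\rho(x)>0$ for every $x\in\mathcal B(\mathcal H)$ with $x\ge 0$ and $x\neq 0$. Let $T:\mathcal B(\mathcal H)\to\mathcal B(\mathcal H)$ be a bounded linear operator which is a Schwarz map, i.e. $T(x)^*T(x)\le T(x^*x)$ for all $x\in\mathcal B(\mathcal H)$, and suppose that $\omega_\rho$ is subinvariant for $T$, i.e. $\omega_\rho(T(a))\le\omega_\rho(a)$ for all $a\ge 0$ in $\mathcal B(\mathcal H)$. Then $\rho^{1/4}x\rho^{1/4}\in\mathcal S_2(\mathcal H)$ for every $x\in\mathcal B(\mathcal H)$, and the map $$\widetilde T(\rho^{1/4}x\rho^{1/4})=\rho^{1/4}T(x)\rho^{1/4},\qquad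 x\in\mathcal B(\mathcal H),$$ is well defined and extends to a linear contraction $\mathcal S_2(\mathcal H)\to\mathcal S_2(\mathcal H)$, that is, to a linear operator on all of $\mathcal S_2(\mathcal H)$ of norm at most $1$ with respect to $\|\cdot\|_2$. -/

import Mathlib

open scoped ComplexOrder InnerProductSpace

noncomputable section

namespace SchwarzMaps

/-! ### Functionals and maps on C*-algebras -/

section CStar

variable {A : Type*} [CStarAlgebra A] [PartialOrder A]

/-- A bounded linear operator `T` on a C*-algebra is a Schwarz map if
`T(x)* T(x) ≤ T(x* x)` for all `x`. -/
def IsSchwarzMap (T : A →L[ℂ] A) : Prop :=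
  ∀ x : A, star (T x) * T x ≤ T (star x * x)

/-- `ω` is faithful if `ω x > 0` for all `x > 0`
(for complex numbers, `0 < z` says that `z` is real and positive). -/
def IsFaithful (ω : A → ℂ) : Prop :=
  ∀ x : A, 0 < x → 0 < ω x

/-- `ω` is subinvariant for `T` if `ω (T a) ≤ ω a` for all `a ≥ 0`. -/
def IsSubinvariant (ω : A → ℂ) (T : A →L[ℂ] A) : Prop :=
  ∀ a : A, 0 ≤ a → ω (T a) ≤ ω a

end CStar

/-! ### Trace-class and Hilbert-Schmidt operators -/

section Operators

variable (H : Type*) [NormedAddCommGroup H] [InnerProductSpace ℂ H] [CompleteSpace H]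

/-- The index set of an orthonormal basis of `H`, fixed once and for all. -/
def basisIndex : Set H := (exists_hilbertBasis ℂ H).choose

/-- An orthonormal basis of `H`, fixed once and for all. The notions defined through it below
do not depend on this choice; see `isHilbertSchmidt_iff`, `isTraceClass_iff` and
`hasSum_omega`. -/
def onb : HilbertBasis (basisIndex H) ℂ H := (exists_hilbertBasis ℂ H).choose_spec.choose

variable {H}

/-- `A` is a trace-class operator: `Tr |A| < ∞`, where `|A| = (A* A)^{1/2}`. -/
def IsTraceClass (A : H →L[ℂ] H) : Prop :=
  Summable fun i => ⟪onb H i, CFC.abs A (onb H i)⟫_ℂ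

/-- The trace `Tr A = ∑ᵢ ⟨eᵢ, A eᵢ⟩` of a trace-class operator `A`. -/
def trace (A : H →L[ℂ] H) : ℂ :=
  ∑' i, ⟪onb H i, A (onb H i)⟫_ℂ

/-- The functional `ω_ρ(x) = Tr (ρ x)` on the bounded operators. -/
def omega (ρ x : H →L[ℂ] H) : ℂ := trace (ρ * x)

/-- `A` is a Hilbert-Schmidt operator: `Tr (A* A) = ∑ᵢ ‖A eᵢ‖² < ∞`. -/
def IsHilbertSchmidt (A : H →L[ℂ] H) : Prop :=
  Summable fun i => ‖A (onb H i)‖ ^ 2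

/-- The map `i_ρ(x) = ρ^{1/4} x ρ^{1/4}` on the bounded operators. -/
def iRho (ρ x : H →L[ℂ] H) : H →L[ℂ] H :=
  ρ ^ (1 / 4 : ℝ) * x * ρ ^ (1 / 4 : ℝ)

/-! Independence of the basis. -/

theorem isHilbertSchmidt_iff_memℓp (A : H →L[ℂ] H) :
    IsHilbertSchmidt A ↔ Memℓp (fun i => A (onb H i)) 2 := by
  rw [memℓp_gen_iff (by simp)]
  simp [IsHilbertSchmidt]

theorem enorm_sq_eq_tsum {ι : Type*} (b : HilbertBasis ι ℂ H) (x : H) :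
    ‖x‖ₑ ^ 2 = ∑' i, ‖⟪b i, x⟫_ℂ‖ₑ ^ 2 := by
  have h : HasSum (fun i => ‖⟪b i, x⟫_ℂ‖ ^ 2) (‖x‖ ^ 2) := by
    have h1 := (lp.hasSum_norm (p := 2) (by simp) (b.repr x))
    simpa [HilbertBasis.repr_apply_apply] using h1
  have h2 := ENNReal.ofReal_tsum_of_nonneg (fun i => by positivity) h.summable
  rw [h.tsum_eq] at h2
  simpa [ENNReal.ofReal_pow, ofReal_norm] using h2

theorem tsum_enorm_sq_adjoint {ι κ : Type*} (b : HilbertBasis ι ℂ H) (c : HilbertBasis κ ℂ H)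
    (A : H →L[ℂ] H) :
    ∑' i, ‖A (b i)‖ₑ ^ 2 = ∑' j, ‖ContinuousLinearMap.adjoint A (c j)‖ₑ ^ 2 := by
  simp_rw [fun i => enorm_sq_eq_tsum c (A (b i)), fun j => enorm_sq_eq_tsum b (ContinuousLinearMap.adjoint A (c j))]
  rw [ENNReal.tsum_comm]
  refine tsum_congr fun j => tsum_congr fun i => ?_
  rw [ContinuousLinearMap.adjoint_inner_right]
  congr 1
  rw [← inner_conj_symm, ← ofReal_norm, ← ofReal_norm, RCLike.norm_conj]

theorem summable_norm_sq_iff {E ι : Type*} [NormedAddCommGroup E] (f : ι → E) :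
    (Summable fun i => ‖f i‖ ^ 2) ↔ ∑' i, ‖f i‖ₑ ^ 2 ≠ ⊤ := by
  have : ∀ i, ‖f i‖ₑ ^ 2 = ((‖f i‖₊ ^ 2 : NNReal) : ENNReal) := fun i => by
    rw [enorm_eq_nnnorm, ENNReal.coe_pow]
  simp_rw [this]
  rw [ENNReal.tsum_coe_ne_top_iff_summable, ← NNReal.summable_coe]
  simp

theorem isHilbertSchmidt_iff {ι : Type*} (b : HilbertBasis ι ℂ H) (A : H →L[ℂ] H) :
    IsHilbertSchmidt A ↔ Summable fun i => ‖A (b i)‖ ^ 2 := by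
  rw [IsHilbertSchmidt, summable_norm_sq_iff, summable_norm_sq_iff,
    tsum_enorm_sq_adjoint (onb H) (onb H), tsum_enorm_sq_adjoint b (onb H)]

theorem inner_abs_eq (A : H →L[ℂ] H) (x : H) :
    ⟪x, CFC.abs A x⟫_ℂ = ((‖CFC.sqrt (CFC.abs A) x‖ ^ 2 : ℝ) : ℂ) := by
  have h0 : (0 : H →L[ℂ] H) ≤ CFC.sqrt (CFC.abs A) := CFC.sqrt_nonneg _
  have h1 : CFC.sqrt (CFC.abs A) * CFC.sqrt (CFC.abs A) = CFC.abs A :=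
    CFC.sqrt_mul_sqrt_self _ (CFC.abs_nonneg A)
  have h2 : ContinuousLinearMap.adjoint (CFC.sqrt (CFC.abs A)) = CFC.sqrt (CFC.abs A) :=
    (IsSelfAdjoint.of_nonneg h0)
  conv_lhs => rw [← h1]
  rw [mul_apply_eq_comp, ← ContinuousLinearMap.adjoint_inner_left, h2,
    inner_self_eq_norm_sq_to_K]
  simp

theorem isTraceClass_iff {ι : Type*} (b : HilbertBasis ι ℂ H) (A : H →L[ℂ] H) :
    IsTraceClass A ↔ Summable fun i => ⟪b i, CFC.abs A (b i)⟫_ℂ := by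
  simp only [IsTraceClass, inner_abs_eq]
  rw [Complex.summable_ofReal, Complex.summable_ofReal]
  exact isHilbertSchmidt_iff b _

theorem ofReal_tsum_norm_sq {A : H →L[ℂ] H} (hA : IsHilbertSchmidt A) {ι : Type*}
    (b : HilbertBasis ι ℂ H) :
    ENNReal.ofReal (∑' i, ‖A (b i)‖ ^ 2) = ∑' i, ‖A (b i)‖ₑ ^ 2 := by
  rw [ENNReal.ofReal_tsum_of_nonneg (fun i => by positivity) ((isHilbertSchmidt_iff b A).1 hA)]
  simp [ENNReal.ofReal_pow, ofReal_norm]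

theorem hasSum_norm_sq {A : H →L[ℂ] H} (hA : IsHilbertSchmidt A) {ι : Type*}
    (b : HilbertBasis ι ℂ H) :
    HasSum (fun i => ‖A (b i)‖ ^ 2) (∑' i, ‖A (onb H i)‖ ^ 2) := by
  have h := ((isHilbertSchmidt_iff b A).1 hA).hasSum
  have h1 := ofReal_tsum_norm_sq hA b
  rw [tsum_enorm_sq_adjoint b (onb H), ← tsum_enorm_sq_adjoint (onb H) (onb H),
    ← ofReal_tsum_norm_sq hA (onb H),
    ENNReal.ofReal_eq_ofReal_iff (tsum_nonneg fun i => by positivity)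
      (tsum_nonneg fun i => by positivity)] at h1
  rwa [h1] at h

theorem IsHilbertSchmidt.add {A B : H →L[ℂ] H} (hA : IsHilbertSchmidt A)
    (hB : IsHilbertSchmidt B) : IsHilbertSchmidt (A + B) :=
  (isHilbertSchmidt_iff_memℓp (A + B)).2
    (((isHilbertSchmidt_iff_memℓp A).1 hA).add ((isHilbertSchmidt_iff_memℓp B).1 hB))

theorem IsHilbertSchmidt.smul {A : H →L[ℂ] H} (c : ℂ) (hA : IsHilbertSchmidt A) :
    IsHilbertSchmidt (c • A) :=
  (isHilbertSchmidt_iff_memℓp (c • A)).2 (((isHilbertSchmidt_iff_memℓp A).1 hA).const_smul c)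

theorem hasSum_inner_polarization {A B : H →L[ℂ] H} (hA : IsHilbertSchmidt A)
    (hB : IsHilbertSchmidt B) {ι : Type*} (b : HilbertBasis ι ℂ H) :
    HasSum (fun i => ⟪A (b i), B (b i)⟫_ℂ)
      ((((∑' i, ‖(A + B) (onb H i)‖ ^ 2 : ℝ) : ℂ)
        - (∑' i, ‖(A + (-1 : ℂ) • B) (onb H i)‖ ^ 2 : ℝ)
        + ((∑' i, ‖(A + (-Complex.I) • B) (onb H i)‖ ^ 2 : ℝ)
          - (∑' i, ‖(A + Complex.I • B) (onb H i)‖ ^ 2 : ℝ)) * Complex.I) / 4) := by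
  have h := fun C (hC : IsHilbertSchmidt C) => Complex.hasSum_ofReal.2 (hasSum_norm_sq hC b)
  have := (((h _ (hA.add hB)).sub (h _ (hA.add (hB.smul (-1))))).add
    (((h _ (hA.add (hB.smul (-Complex.I)))).sub
      (h _ (hA.add (hB.smul Complex.I)))).mul_right Complex.I)).div_const 4
  convert! this using 2 with i
  rw [inner_eq_sum_norm_sq_div_four (𝕜 := ℂ)]
  simp [sub_eq_add_neg]

theorem hasSum_inner {A B : H →L[ℂ] H} (hA : IsHilbertSchmidt A) (hB : IsHilbertSchmidt B)
    {ι : Type*} (b : HilbertBasis ι ℂ H) :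
    HasSum (fun i => ⟪A (b i), B (b i)⟫_ℂ) (∑' i, ⟪A (onb H i), B (onb H i)⟫_ℂ) := by
  rw [(hasSum_inner_polarization hA hB (onb H)).tsum_eq]
  exact hasSum_inner_polarization hA hB b

theorem IsHilbertSchmidt.adjoint {A : H →L[ℂ] H} (hA : IsHilbertSchmidt A) :
    IsHilbertSchmidt (ContinuousLinearMap.adjoint A) := by
  rw [IsHilbertSchmidt, summable_norm_sq_iff, ← tsum_enorm_sq_adjoint (onb H) (onb H),
    ← summable_norm_sq_iff]
  exact hA

theorem IsHilbertSchmidt.mul_left {A : H →L[ℂ] H} (x : H →L[ℂ] H) (hA : IsHilbertSchmidt A) :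
    IsHilbertSchmidt (x * A) := by
  refine Summable.of_nonneg_of_le (fun i => by positivity) (fun i => ?_)
    (Summable.mul_left (‖x‖ ^ 2) hA)
  rw [← mul_pow]
  exact pow_le_pow_left₀ (norm_nonneg _) (x.le_opNorm _) 2

theorem IsHilbertSchmidt.mul_right {A : H →L[ℂ] H} (x : H →L[ℂ] H) (hA : IsHilbertSchmidt A) :
    IsHilbertSchmidt (A * x) := by
  have h := ((hA.adjoint).mul_left (ContinuousLinearMap.adjoint x)).adjoint
  simpa [← ContinuousLinearMap.star_eq_adjoint] using h

theorem hasSum_omega {ρ : H →L[ℂ] H} (hρ : 0 ≤ ρ) (hρ_tr : IsTraceClass ρ) (x : H →L[ℂ] H)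
    {ι : Type*} (b : HilbertBasis ι ℂ H) :
    HasSum (fun i => ⟪b i, (ρ * x) (b i)⟫_ℂ) (omega ρ x) := by
  have habs : CFC.abs ρ = ρ := CFC.abs_of_nonneg ρ hρ
  have hr : IsHilbertSchmidt (CFC.sqrt ρ) := by
    simp only [IsTraceClass, inner_abs_eq] at hρ_tr
    rw [Complex.summable_ofReal, habs] at hρ_tr
    exact hρ_tr
  have h2 : ContinuousLinearMap.adjoint (CFC.sqrt ρ) = CFC.sqrt ρ :=
    IsSelfAdjoint.of_nonneg (CFC.sqrt_nonneg ρ)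
  have key : ∀ v : H, ⟪v, (ρ * x) v⟫_ℂ = ⟪CFC.sqrt ρ v, (CFC.sqrt ρ * x) v⟫_ℂ := by
    intro v
    conv_lhs => rw [← CFC.sqrt_mul_sqrt_self ρ hρ, mul_assoc]
    nth_rewrite 3 [← h2]
    rw [ContinuousLinearMap.adjoint_inner_left]
    rfl
  simp only [omega, trace, key]
  exact hasSum_inner hr (hr.mul_right x) b

/-! ### The Hilbert-Schmidt space -/

variable (H)

/-- The Hilbert-Schmidt operators as a linear subspace of the bounded operators. -/
def hilbertSchmidtSubmodule : Submodule ℂ (H →L[ℂ] H) where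
  carrier := {A | IsHilbertSchmidt A}
  zero_mem' := by simp [IsHilbertSchmidt, summable_zero]
  add_mem' := fun hA hB => hA.add hB
  smul_mem' := fun c _ hA => hA.smul c

/-- The space `S₂(H)` of Hilbert-Schmidt operators. It is a type of its own because it carries
the Hilbert-Schmidt norm below and not the operator norm. -/
def S2 : Type _ := hilbertSchmidtSubmodule H

instance : AddCommGroup (S2 H) := inferInstanceAs (AddCommGroup (hilbertSchmidtSubmodule H))

instance : Module ℂ (S2 H) := inferInstanceAs (Module ℂ (hilbertSchmidtSubmodule H))

variable {H}

/-- A Hilbert-Schmidt operator as an element of `S₂(H)`. -/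
def S2.mk (A : H →L[ℂ] H) (hA : IsHilbertSchmidt A) : S2 H := Subtype.mk A hA

variable (H) in
/-- The inclusion of `S₂(H)` into the bounded operators. -/
def S2.toOp : S2 H →ₗ[ℂ] (H →L[ℂ] H) := (hilbertSchmidtSubmodule H).subtype

theorem S2.isHilbertSchmidt (A : S2 H) : IsHilbertSchmidt (S2.toOp H A) := A.2

@[simp]
theorem S2.toOp_mk (A : H →L[ℂ] H) (hA : IsHilbertSchmidt A) : S2.toOp H (S2.mk A hA) = A := rfl

theorem S2.ext {A B : S2 H} (h : S2.toOp H A = S2.toOp H B) : A = B := Subtype.ext h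

theorem S2.summable_inner (A B : S2 H) :
    Summable fun i => ⟪S2.toOp H A (onb H i), S2.toOp H B (onb H i)⟫_ℂ :=
  lp.summable_inner (𝕜 := ℂ)
    (⟨_, (isHilbertSchmidt_iff_memℓp _).1 A.isHilbertSchmidt⟩ :
      lp (fun _ : basisIndex H => H) 2)
    ⟨_, (isHilbertSchmidt_iff_memℓp _).1 B.isHilbertSchmidt⟩

variable (H) in
/-- The Hilbert-Schmidt inner product `⟨A, B⟩ = Tr (A* B) = ∑ᵢ ⟨A eᵢ, B eᵢ⟩`. -/
abbrev S2.core : InnerProductSpace.Core ℂ (S2 H) where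
  inner A B := ∑' i, ⟪S2.toOp H A (onb H i), S2.toOp H B (onb H i)⟫_ℂ
  conj_inner_symm A B := by
    change (starRingEnd ℂ) (∑' i, ⟪S2.toOp H B (onb H i), S2.toOp H A (onb H i)⟫_ℂ) =
      ∑' i, ⟪S2.toOp H A (onb H i), S2.toOp H B (onb H i)⟫_ℂ
    rw [Complex.conj_tsum]
    exact tsum_congr fun i => inner_conj_symm _ _
  re_inner_nonneg A := by
    change 0 ≤ (∑' i, ⟪S2.toOp H A (onb H i), S2.toOp H A (onb H i)⟫_ℂ).re
    rw [Complex.re_tsum (S2.summable_inner A A)]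
    exact tsum_nonneg fun i => inner_self_nonneg (𝕜 := ℂ)
  add_left A B C := by
    change (∑' i, ⟪S2.toOp H (A + B) (onb H i), S2.toOp H C (onb H i)⟫_ℂ) =
      (∑' i, ⟪S2.toOp H A (onb H i), S2.toOp H C (onb H i)⟫_ℂ) +
        ∑' i, ⟪S2.toOp H B (onb H i), S2.toOp H C (onb H i)⟫_ℂ
    rw [← (S2.summable_inner A C).tsum_add (S2.summable_inner B C)]
    exact tsum_congr fun i => by
      rw [map_add, add_apply, inner_add_left]
  smul_left A B c := by
    change (∑' i, ⟪S2.toOp H (c • A) (onb H i), S2.toOp H B (onb H i)⟫_ℂ) =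
      (starRingEnd ℂ) c * ∑' i, ⟪S2.toOp H A (onb H i), S2.toOp H B (onb H i)⟫_ℂ
    rw [← tsum_mul_left]
    exact tsum_congr fun i => by
      rw [map_smul, smul_apply, inner_smul_left]
  definite A hA := by
    change (∑' i, ⟪S2.toOp H A (onb H i), S2.toOp H A (onb H i)⟫_ℂ) = 0 at hA
    have h1 := congrArg Complex.re hA
    rw [Complex.re_tsum (S2.summable_inner A A)] at h1
    have h2 : ∀ i, S2.toOp H A (onb H i) = 0 := by
      have hs := (Complex.hasSum_re (S2.summable_inner A A).hasSum).summable
      have h0 : (0 : basisIndex H → ℝ) ≤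
          fun i => (⟪S2.toOp H A (onb H i), S2.toOp H A (onb H i)⟫_ℂ).re :=
        fun i => inner_self_nonneg (𝕜 := ℂ) (x := S2.toOp H A (onb H i))
      have h3 := hs.hasSum_iff.2 h1
      rw [Complex.zero_re, hasSum_zero_iff_of_nonneg h0] at h3
      intro i
      have h4 : RCLike.re ⟪S2.toOp H A (onb H i), S2.toOp H A (onb H i)⟫_ℂ = 0 := congrFun h3 i
      rw [inner_self_eq_norm_sq] at h4
      simpa using h4
    apply S2.ext
    rw [map_zero]
    refine ContinuousLinearMap.ext_on (s := Set.range (onb H))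
      (Submodule.dense_iff_topologicalClosure_eq_top.2 (onb H).dense_span) ?_
    rintro _ ⟨i, rfl⟩
    simpa using h2 i

instance : NormedAddCommGroup (S2 H) := (S2.core H).toNormedAddCommGroup

instance : InnerProductSpace ℂ (S2 H) := InnerProductSpace.ofCore (S2.core H).toCore

theorem S2.norm_sq_eq (A : S2 H) : ‖A‖ ^ 2 = ∑' i, ‖S2.toOp H A (onb H i)‖ ^ 2 := by
  rw [← inner_self_eq_norm_sq (𝕜 := ℂ)]
  change (∑' i, ⟪S2.toOp H A (onb H i), S2.toOp H A (onb H i)⟫_ℂ).re = _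
  rw [Complex.re_tsum (S2.summable_inner A A)]
  exact tsum_congr fun i => inner_self_eq_norm_sq (𝕜 := ℂ) _

end Operators

end SchwarzMaps

end

open SchwarzMaps

universe u

/-! Write `R = ρ^{1/4}`. Since `ω_ρ(x* x) = ‖x R²‖₂²`, the Schwarz inequality and subinvariance make
`T` a contraction for `‖x R²‖₂`. As `T` is positive it commutes with `star`, so it also contracts
`‖R² x‖₂`. The norm `‖R x R‖₂` lies midway between these two, and the theorem is an interpolation
statement (`norm_sandwich_map_le`).

The interpolation is elementary. The identity `⟨R x R, R y R⟩ = ⟨x R², R² y⟩` and Cauchy-Schwarz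
bound the form `⟨R T(x) R, R T(y) R⟩` by `‖x R²‖₂ ‖R² y‖₂`. In an eigenbasis of `R` all three norms
are weighted ℓ² norms of the matrix coefficients, and after normalization by the symmetric norm the
one-sided weights are inverse to each other. On finitely many coefficients a top singular vector
then gives the contraction (`norm_map_le_of_weighted_bound`). Truncation extends it to every `x`,
and density of the operators `R x R` in `S₂` gives the extension. Faithfulness makes the eigenvalues
of `R` positive, which both the normalization and the density require. -/

theorem SchwarzMaps.IsSchwarzMap.map_nonneg {A : Type*} [CStarAlgebra A] [PartialOrder A]
    [StarOrderedRing A] {T : A →L[ℂ] A} (hT : IsSchwarzMap T) {a : A} (ha : 0 ≤ a) : 0 ≤ T a := by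
  obtain ⟨s, rfl⟩ := CStarAlgebra.nonneg_iff_eq_star_mul_self.1 ha
  exact (star_mul_self_nonneg _).trans (hT s)

/-- Turns the bound on `‖x R²‖₂` into the one on `‖R² x‖₂`. -/
theorem SchwarzMaps.IsSchwarzMap.map_star {A : Type*} [CStarAlgebra A] [PartialOrder A]
    [StarOrderedRing A] {T : A →L[ℂ] A} (hT : IsSchwarzMap T) (a : A) :
    T (star a) = star (T a) :=
  StarHomClass.map_star (PositiveLinearMap.mk₀ (T : A →ₗ[ℂ] A) fun _ ha => hT.map_nonneg ha) a

/-! ### Finite-dimensional interpolation -/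

/-- The top singular value of a linear map on a finite-dimensional space is attained. -/
theorem exists_top_singular_vector {E K : Type*} [NormedAddCommGroup E] [InnerProductSpace ℂ E]
    [FiniteDimensional ℂ E] [Nontrivial E] [NormedAddCommGroup K] [InnerProductSpace ℂ K]
    (A : E →ₗ[ℂ] K) :
    ∃ (μ : ℝ) (v : E), v ≠ 0 ∧ (∀ y, ⟪A y, A v⟫_ℂ = μ * ⟪y, v⟫_ℂ) ∧
      ∀ x, ‖A x‖ ^ 2 ≤ μ * ‖x‖ ^ 2 := by
  -- `K` need not be complete; the range of `A` is finite-dimensional, so the adjoint exists there.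
  let B := A.rangeRestrict
  let G := LinearMap.adjoint B ∘ₗ B
  have hG : ∀ y z, ⟪y, G z⟫_ℂ = ⟪A y, A z⟫_ℂ := fun y z =>
    LinearMap.adjoint_inner_right B y (B z)
  have hsymm : G.IsSymmetric := fun y z => by
    rw [hG, ← inner_conj_symm, hG, inner_conj_symm]
  have hbdd : BddAbove (Set.range fun x : {x : E // x ≠ 0} =>
      RCLike.re ⟪G x, (x : E)⟫_ℂ / ‖(x : E)‖ ^ 2) := by
    refine ⟨‖G.toContinuousLinearMap‖, ?_⟩
    rintro _ ⟨y, rfl⟩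
    exact (le_abs_self _).trans (G.toContinuousLinearMap.rayleighQuotient_le_norm y)
  obtain ⟨v, hv⟩ := hsymm.hasEigenvalue_iSup_of_finiteDimensional.exists_hasEigenvector
  refine ⟨⨆ x : {x : E // x ≠ 0}, RCLike.re ⟪G x, (x : E)⟫_ℂ / ‖(x : E)‖ ^ 2, v, hv.2,
    fun y => ?_, fun x => ?_⟩
  rotate_left
  · rcases eq_or_ne x 0 with rfl | hx
    · simp
    have h5 := le_ciSup hbdd ⟨x, hx⟩
    have hx0 := norm_pos_iff.2 hx
    rw [div_le_iff₀ (by positivity)] at h5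
    refine le_trans (le_of_eq ?_) h5
    rw [hsymm, hG, inner_self_eq_norm_sq]
  · rw [← hG, hv.apply_eq_smul, inner_smul_right]
    rfl

/-- A positive form on `ℂ^κ` bounded by the geometric pairing of the weights `w⁻¹` and `w`
is bounded by the standard form. -/
theorem norm_map_le_of_weighted_bound {κ K : Type*} [Fintype κ] [NormedAddCommGroup K]
    [InnerProductSpace ℂ K] (A : EuclideanSpace ℂ κ →ₗ[ℂ] K) (w : κ → ℝ) (hw : ∀ k, 0 < w k)
    (h : ∀ x y : EuclideanSpace ℂ κ, ‖⟪A x, A y⟫_ℂ‖ ^ 2 ≤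
      (∑ k, (w k)⁻¹ * ‖x k‖ ^ 2) * ∑ k, w k * ‖y k‖ ^ 2) (x : EuclideanSpace ℂ κ) :
    ‖A x‖ ≤ ‖x‖ := by
  rcases eq_or_ne x 0 with rfl | hx
  · simp
  have : Nontrivial (EuclideanSpace ℂ κ) := ⟨x, 0, hx⟩
  obtain ⟨μ, v, hv0, hv, hle⟩ := exists_top_singular_vector A
  have hμ1 : μ ≤ 1 := by
    -- Test the bound on the pair `(W v, v)`, where `W` multiplies by `w`: the form equals `μ s` and
    -- both weighted sums equal `s`, so `μ² s² ≤ s²`.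
    let y : EuclideanSpace ℂ κ := WithLp.toLp 2 fun k => (w k : ℂ) * v k
    let s : ℝ := ∑ k, w k * ‖v k‖ ^ 2
    have hs : 0 < s := by
      obtain ⟨k, hk⟩ : ∃ k, v k ≠ 0 := by
        by_contra! hc
        exact hv0 (by ext k; simpa using hc k)
      refine Finset.sum_pos' (fun k _ => by have := hw k; positivity) ⟨k, Finset.mem_univ _, ?_⟩
      have := hw k
      have := norm_pos_iff.2 hk
      positivity
    have h1 : ⟪A y, A v⟫_ℂ = ((μ * s : ℝ) : ℂ) := by
      rw [hv, PiLp.inner_apply]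
      push_cast [s]
      congr 1
      refine Finset.sum_congr rfl fun k _ => ?_
      simp only [y, RCLike.inner_apply, map_mul, Complex.conj_ofReal, ← Complex.mul_conj']
      ring
    have h2 : ∑ k, (w k)⁻¹ * ‖y k‖ ^ 2 = s := by
      refine Finset.sum_congr rfl fun k _ => ?_
      have := hw k
      simp only [y, norm_mul, Complex.norm_real, Real.norm_eq_abs, mul_pow, sq_abs]
      field_simp
    have h3 := h y v
    rw [h1, h2, Complex.norm_real, Real.norm_eq_abs, sq_abs, ← sq, mul_pow] at h3
    have h4 : μ ^ 2 ≤ 1 := by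
      by_contra! hc
      nlinarith [pow_pos hs 2]
    nlinarith
  refine (sq_le_sq₀ (norm_nonneg _) (norm_nonneg _)).1 ((hle x).trans ?_)
  exact mul_le_of_le_one_left (sq_nonneg _) hμ1

/-! ### Parseval, completeness and compactness for Hilbert-Schmidt operators -/

namespace SchwarzMaps
variable {H : Type*} [NormedAddCommGroup H] [InnerProductSpace ℂ H] [CompleteSpace H]

omit [CompleteSpace H] in
theorem hasSum_norm_inner_sq {ι : Type*} (b : HilbertBasis ι ℂ H) (x : H) :
    HasSum (fun i => ‖⟪b i, x⟫_ℂ‖ ^ 2) (‖x‖ ^ 2) := by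
  simpa [HilbertBasis.repr_apply_apply] using lp.hasSum_norm (p := 2) (by simp) (b.repr x)

theorem S2.hasSum_norm_sq (A : S2 H) {ι : Type*} (b : HilbertBasis ι ℂ H) :
    HasSum (fun i => ‖S2.toOp H A (b i)‖ ^ 2) (‖A‖ ^ 2) :=
  A.norm_sq_eq ▸ SchwarzMaps.hasSum_norm_sq A.isHilbertSchmidt b

theorem S2.hasSum_inner (A B : S2 H) {ι : Type*} (b : HilbertBasis ι ℂ H) :
    HasSum (fun i => ⟪S2.toOp H A (b i), S2.toOp H B (b i)⟫_ℂ) ⟪A, B⟫_ℂ :=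
  SchwarzMaps.hasSum_inner A.isHilbertSchmidt B.isHilbertSchmidt b

/-- Parseval's identity for the matrix coefficients of a Hilbert-Schmidt operator. -/
theorem S2.hasSum_norm_coeff_sq (A : S2 H) {ι : Type*} (b : HilbertBasis ι ℂ H) :
    HasSum (fun p : ι × ι => ‖⟪b p.2, S2.toOp H A (b p.1)⟫_ℂ‖ ^ 2) (‖A‖ ^ 2) := by
  have h1 := fun j => hasSum_norm_inner_sq b (S2.toOp H A (b j))
  have h2 := A.hasSum_norm_sq b
  have hs : Summable fun p : ι × ι => ‖⟪b p.2, S2.toOp H A (b p.1)⟫_ℂ‖ ^ 2 := by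
    refine (summable_prod_of_nonneg fun p => sq_nonneg _).2 ⟨fun j => (h1 j).summable, ?_⟩
    simpa only [(h1 _).tsum_eq] using h2.summable
  exact (hs.hasSum.prod_fiberwise h1).unique h2 ▸ hs.hasSum

theorem S2.norm_mk_adjoint {A : H →L[ℂ] H} (hA : IsHilbertSchmidt A) :
    ‖S2.mk (ContinuousLinearMap.adjoint A) hA.adjoint‖ = ‖S2.mk A hA‖ := by
  have h1 := (S2.mk _ hA.adjoint).hasSum_norm_coeff_sq (onb H)
  have h2 := (S2.mk A hA).hasSum_norm_coeff_sq (onb H)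
  rw [← (Equiv.prodComm _ _).hasSum_iff] at h2
  refine (sq_eq_sq₀ (norm_nonneg _) (norm_nonneg _)).1 (h1.unique ?_)
  convert! h2 using 3 with p
  simp only [S2.toOp_mk, Function.comp, Equiv.prodComm_apply, Prod.fst_swap, Prod.snd_swap]
  rw [ContinuousLinearMap.adjoint_inner_right, ← inner_conj_symm, RCLike.norm_conj]

/-- The coordinates of `A x` are `⟨A* eᵢ, x⟩`; apply Cauchy-Schwarz to each and sum. -/
theorem S2.norm_toOp_le (A : S2 H) : ‖S2.toOp H A‖ ≤ ‖A‖ := by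
  refine ContinuousLinearMap.opNorm_le_bound _ (norm_nonneg _) fun x => ?_
  have h1 := hasSum_norm_inner_sq (onb H) (S2.toOp H A x)
  have h2 := ((S2.mk _ A.isHilbertSchmidt.adjoint).hasSum_norm_sq (onb H)).mul_right (‖x‖ ^ 2)
  refine (sq_le_sq₀ (norm_nonneg _) (by positivity)).1 ?_
  rw [mul_pow]
  have h3 := hasSum_le (fun i => ?_) h1 h2
  · rwa [S2.norm_mk_adjoint] at h3
  · rw [← ContinuousLinearMap.adjoint_inner_left, ← mul_pow]
    exact pow_le_pow_left₀ (norm_nonneg _) (norm_inner_le_norm _ _) 2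

/-- A Cauchy sequence converges in operator norm; the Hilbert-Schmidt bounds pass to the limit on
finite partial sums, uniformly in the finite set. -/
instance : CompleteSpace (S2 H) := by
  refine Metric.complete_of_cauchySeq_tendsto fun u hu => ?_
  have hop : CauchySeq fun n => S2.toOp H (u n) := by
    refine Metric.cauchySeq_iff.2 fun ε hε => ?_
    obtain ⟨N, hN⟩ := Metric.cauchySeq_iff.1 hu ε hε
    refine ⟨N, fun m hm n hn => lt_of_le_of_lt ?_ (hN m hm n hn)⟩
    rw [dist_eq_norm, dist_eq_norm, ← map_sub]
    exact S2.norm_toOp_le _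
  obtain ⟨A, hA⟩ := cauchySeq_tendsto_of_complete hop
  have key : ∀ ε > 0, ∃ N, ∀ n ≥ N, ∀ F : Finset (basisIndex H),
      ∑ i ∈ F, ‖(S2.toOp H (u n) - A) (onb H i)‖ ^ 2 ≤ ε ^ 2 := by
    intro ε hε
    obtain ⟨N, hN⟩ := Metric.cauchySeq_iff.1 hu ε hε
    refine ⟨N, fun n hn F => ?_⟩
    have hlim : Filter.Tendsto
        (fun m => ∑ i ∈ F, ‖(S2.toOp H (u n) - S2.toOp H (u m)) (onb H i)‖ ^ 2) Filter.atTop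
        (nhds (∑ i ∈ F, ‖(S2.toOp H (u n) - A) (onb H i)‖ ^ 2)) := by
      refine tendsto_finsetSum _ fun i _ => ?_
      have h1 : Filter.Tendsto (fun m => (S2.toOp H (u n) - S2.toOp H (u m)) (onb H i))
          Filter.atTop (nhds ((S2.toOp H (u n) - A) (onb H i))) :=
        ((ContinuousLinearMap.apply ℂ H (onb H i)).continuous.tendsto _).comp
          (tendsto_const_nhds.sub hA)
      exact h1.norm.pow 2
    refine le_of_tendsto hlim (Filter.eventually_atTop.2 ⟨N, fun m hm => ?_⟩)
    have h2 := hN n hn m hm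
    rw [dist_eq_norm] at h2
    rw [← map_sub]
    exact (sum_le_hasSum F (fun i _ => sq_nonneg _) ((u n - u m).hasSum_norm_sq (onb H))).trans
      (pow_le_pow_left₀ (norm_nonneg _) h2.le 2)
  have hHS : IsHilbertSchmidt A := by
    obtain ⟨N, hN⟩ := key 1 one_pos
    have h1 : IsHilbertSchmidt (S2.toOp H (u N) - A) :=
      summable_of_sum_le (fun i => sq_nonneg _) (hN N le_rfl)
    simpa using (u N).isHilbertSchmidt.add (h1.smul (-1))
  refine ⟨S2.mk A hHS, Metric.tendsto_atTop.2 fun ε hε => ?_⟩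
  obtain ⟨N, hN⟩ := key (ε / 2) (half_pos hε)
  refine ⟨N, fun n hn => lt_of_le_of_lt ?_ (half_lt_self hε)⟩
  rw [dist_eq_norm]
  refine (sq_le_sq₀ (norm_nonneg _) (half_pos hε).le).1 ?_
  exact hasSum_le_of_sum_le ((u n - S2.mk A hHS).hasSum_norm_sq (onb H)) (hN n hn)

theorem hasSum_sub_finset_sum {β : Type*} [DecidableEq β] {f : β → ℝ} {a : ℝ} (h : HasSum f a)
    (s : Finset β) : HasSum (fun i => if i ∈ s then 0 else f i) (a - ∑ i ∈ s, f i) := by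
  have h1 := hasSum_sum_of_ne_finset_zero (f := fun i => if i ∈ s then f i else 0)
    (s := s) (L := .unconditional _) (fun i hi => if_neg hi)
  rw [Finset.sum_congr rfl fun i hi => if_pos hi] at h1
  convert! h.sub h1 using 2 with i
  split_ifs <;> simp

/-- The finite-rank truncations `F s` converge to `A` in `‖·‖₂`, which dominates the operator norm.
-/
theorem IsHilbertSchmidt.isCompactOperator {A : H →L[ℂ] H} (hA : IsHilbertSchmidt A) :
    IsCompactOperator A := by
  classical
  let F : Finset (basisIndex H) → H →L[ℂ] H := fun s =>
    ∑ i ∈ s, InnerProductSpace.rankOne ℂ (A (onb H i)) (onb H i)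
  have hF : ∀ s j, F s (onb H j) = if j ∈ s then A (onb H j) else 0 := fun s j => by
    simp [F, orthonormal_iff_ite.1 (onb H).orthonormal]
  have hsum : ∀ s, HasSum (fun i => ‖(A - F s) (onb H i)‖ ^ 2)
      (‖S2.mk A hA‖ ^ 2 - ∑ i ∈ s, ‖A (onb H i)‖ ^ 2) := fun s => by
    convert! hasSum_sub_finset_sum ((S2.mk A hA).hasSum_norm_sq (onb H)) s using 2 with i
    rw [sub_apply, hF]
    split_ifs <;> simp
  have hcompact : ∀ s, IsCompactOperator (F s) := fun s =>
    Submodule.sum_mem (compactOperator (RingHom.id ℂ) H H) fun i _ =>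
      ((isCompactOperator_id (E := ℂ)).comp_clm (innerSL ℂ (onb H i))).clm_comp
        (ContinuousLinearMap.toSpanSingleton ℂ (A (onb H i)))
  have hlim : Filter.Tendsto (fun s => √(‖S2.mk A hA‖ ^ 2 - ∑ i ∈ s, ‖A (onb H i)‖ ^ 2))
      Filter.atTop (nhds 0) := by
    have h1 : Filter.Tendsto (fun s => ∑ i ∈ s, ‖A (onb H i)‖ ^ 2) Filter.atTop
        (nhds (‖S2.mk A hA‖ ^ 2)) :=
      (S2.mk A hA).hasSum_norm_sq (onb H)
    have h2 := (h1.const_sub (‖S2.mk A hA‖ ^ 2)).sqrt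
    rwa [sub_self, Real.sqrt_zero] at h2
  refine isCompactOperator_of_tendsto (F := F) (l := Filter.atTop) ?_
    (Filter.Eventually.of_forall hcompact)
  rw [tendsto_iff_norm_sub_tendsto_zero]
  refine squeeze_zero (fun _ => norm_nonneg _) (fun s => ?_) hlim
  have hHS : IsHilbertSchmidt (A - F s) := (hsum s).summable
  rw [norm_sub_rev]
  refine (S2.norm_toOp_le (S2.mk _ hHS)).trans (Real.le_sqrt_of_sq_le (le_of_eq ?_))
  exact ((S2.mk _ hHS).hasSum_norm_sq (onb H)).unique (hsum s)

/-! ### Diagonalization of the fourth root -/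

/-- A compact symmetric operator has a Hilbert basis of eigenvectors. -/
theorem exists_hilbertBasis_eigenvectors {H : Type u} [NormedAddCommGroup H]
    [InnerProductSpace ℂ H] [CompleteSpace H] {A : H →L[ℂ] H} (hc : IsCompactOperator A)
    (hs : A.IsSymmetric) :
    ∃ (ι : Type u) (b : HilbertBasis ι ℂ H) (l : ι → ℂ), ∀ i, A (b i) = l i • b i := by
  let V : ℂ → Submodule ℂ H := fun μ => Module.End.eigenspace (A : Module.End ℂ H) μ
  have hV : ∀ μ, IsClosed (V μ : Set H) := fun μ => by
    have : (V μ : Set H) = {x | A x = μ • x} := by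
      ext x
      exact Module.End.mem_eigenspace_iff
    rw [this]
    exact isClosed_eq A.continuous (continuous_const_smul μ)
  have : ∀ μ, CompleteSpace (V μ) := fun μ => (hV μ).completeSpace_coe
  choose w c hcw using fun μ => exists_hilbertBasis ℂ (V μ)
  have hon : Orthonormal ℂ fun a : Σ μ, w μ => ((c a.1 a.2 : V a.1) : H) :=
    hs.orthogonalFamily_eigenspaces.orthonormal_sigma_orthonormal fun μ => (c μ).orthonormal
  refine ⟨Σ μ, w μ, HilbertBasis.mkOfOrthogonalEqBot hon ?_, fun a => a.1, fun a => ?_⟩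
  · rw [eq_bot_iff, ← ContinuousLinearMap.orthogonalComplement_iSup_eigenspaces_eq_bot hc hs]
    intro x hx
    rw [← Submodule.iInf_orthogonal, Submodule.mem_iInf]
    intro μ
    rw [Submodule.mem_orthogonal]
    intro u hu
    -- The functional `⟨x, ·⟩` vanishes on a basis of the eigenspace, hence on all of it.
    have h1 := (innerSL ℂ x ∘L (V μ).subtypeL).ext_on (g := 0) (s := Set.range (c μ))
      (Submodule.dense_iff_topologicalClosure_eq_top.2 (c μ).dense_span) (by
        rintro _ ⟨i, rfl⟩
        exact Submodule.inner_left_of_mem_orthogonal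
          (Submodule.subset_span (Set.mem_range_self (⟨μ, i⟩ : Σ μ, w μ))) hx)
    rw [inner_eq_zero_symm]
    simpa using DFunLike.congr_fun h1 ⟨u, hu⟩
  · rw [HilbertBasis.coe_mkOfOrthogonalEqBot]
    exact Module.End.mem_eigenspace_iff.1 (c a.1 a.2).2

omit [CompleteSpace H] in
/-- An eigenvector of the square of a positive operator is an eigenvector of the operator. -/
theorem apply_eq_smul_of_mul_self {S : H →L[ℂ] H} (hS : 0 ≤ S) {c : ℝ} (hc : 0 < c) {x : H}
    (h : (S * S) x = ((c ^ 2 : ℝ) : ℂ) • x) : S x = (c : ℂ) • x := by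
  -- The defect `S x - c x` satisfies the eigenvalue equation for `-c < 0`, so positivity of `S`
  -- forces it to vanish.
  have h1 : S (S x - (c : ℂ) • x) = -(c : ℂ) • (S x - (c : ℂ) • x) := by
    have h' : S (S x) = ((c ^ 2 : ℝ) : ℂ) • x := h
    rw [map_sub, map_smul, h', Complex.ofReal_pow]
    module
  have h2 := ((ContinuousLinearMap.nonneg_iff_isPositive S).1 hS).re_inner_nonneg_right
    (S x - (c : ℂ) • x)
  rw [h1, ← Complex.ofReal_neg, inner_smul_right, inner_self_eq_norm_sq_to_K] at h2
  replace h2 : 0 ≤ -c * ‖S x - (c : ℂ) • x‖ ^ 2 := by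
    simpa [Complex.re_ofReal_mul, ← Complex.ofReal_pow, -Complex.ofReal_neg] using h2
  have h3 : ‖S x - (c : ℂ) • x‖ ^ 2 ≤ 0 := by nlinarith [sq_nonneg ‖S x - (c : ℂ) • x‖]
  rw [← sub_eq_zero, ← norm_eq_zero]
  exact pow_eq_zero_iff two_ne_zero |>.1 (le_antisymm h3 (sq_nonneg _))

section Roots

variable {ρ : H →L[ℂ] H} (hρ : 0 ≤ ρ) (hρ_tr : IsTraceClass ρ)

include hρ

theorem rpow_quarter_mul_self : ρ ^ (1 / 4 : ℝ) * ρ ^ (1 / 4 : ℝ) = CFC.sqrt ρ := by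
  have : ρ ^ (1 / 4 : ℝ) = CFC.sqrt (CFC.sqrt ρ) := by
    rw [CFC.sqrt_eq_rpow, CFC.sqrt_eq_rpow,
      CFC.rpow_rpow_of_exponent_nonneg ρ _ _ (by norm_num) (by norm_num) hρ]
    norm_num
  rw [this, CFC.sqrt_mul_sqrt_self _ (CFC.sqrt_nonneg ρ)]

include hρ_tr

theorem isHilbertSchmidt_sqrt : IsHilbertSchmidt (CFC.sqrt ρ) := by
  have h := hρ_tr
  simp only [IsTraceClass, inner_abs_eq] at h
  rw [CFC.abs_of_nonneg ρ hρ] at h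
  exact Complex.summable_ofReal.1 h

end Roots

omit [CompleteSpace H] in
theorem isSymmetric_of_nonneg {S : H →L[ℂ] H} (hS : 0 ≤ S) : S.IsSymmetric :=
  ((ContinuousLinearMap.nonneg_iff_isPositive S).1 hS).isSymmetric

omit [CompleteSpace H] in
theorem inner_basis_self {ι : Type*} (b : HilbertBasis ι ℂ H) (i : ι) : ⟪b i, b i⟫_ℂ = 1 := by
  rw [inner_self_eq_norm_sq_to_K, b.orthonormal.1 i]
  simp

/-- The functional takes the value `l` on the projection onto the line of `b i`. -/
theorem eigenvalue_pos_of_isFaithful {ρ : H →L[ℂ] H} (hρ : 0 ≤ ρ)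
    (hρ_tr : IsTraceClass ρ) (hρ_faithful : IsFaithful (omega ρ)) {ι : Type*}
    (b : HilbertBasis ι ℂ H) {i : ι} {l : ℂ} (hl : ρ (b i) = l • b i) : 0 < l := by
  have hn := inner_basis_self b i
  have hP : (0 : H →L[ℂ] H) < InnerProductSpace.rankOne ℂ (b i) (b i) := by
    refine lt_of_le_of_ne ?_ fun h0 => ?_
    · rw [ContinuousLinearMap.nonneg_iff_isPositive]
      exact InnerProductSpace.isPositive_rankOne_self (b i)
    · have h1 := DFunLike.congr_fun h0 (b i)
      simp only [InnerProductSpace.rankOne_apply, hn, one_smul, zero_apply] at h1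
      exact b.orthonormal.ne_zero i h1.symm
  have h1 := hρ_faithful _ hP
  have h2 := hasSum_omega hρ hρ_tr (InnerProductSpace.rankOne ℂ (b i) (b i)) b
  have h3 : ∀ j, ⟪b j, (ρ * InnerProductSpace.rankOne ℂ (b i) (b i)) (b j)⟫_ℂ =
      ⟪b i, b j⟫_ℂ * (l * ⟪b j, b i⟫_ℂ) := fun j => by simp [hl]
  simp only [h3] at h2
  have h4 := hasSum_single (L := .unconditional _)
    (f := fun j => ⟪b i, b j⟫_ℂ * (l * ⟪b j, b i⟫_ℂ)) i
    fun j hj => by simp [b.orthonormal.2 hj.symm]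
  rw [h2.unique h4, hn] at h1
  simpa using h1

/-- A faithful trace-class density has a Hilbert basis that diagonalizes its fourth root, with
positive eigenvalues. -/
theorem exists_hilbertBasis_rpow_quarter {H : Type u} [NormedAddCommGroup H]
    [InnerProductSpace ℂ H] [CompleteSpace H] {ρ : H →L[ℂ] H} (hρ : 0 ≤ ρ)
    (hρ_tr : IsTraceClass ρ) (hρ_faithful : IsFaithful (omega ρ)) :
    ∃ (ι : Type u) (b : HilbertBasis ι ℂ H) (m : ι → ℝ), (∀ i, 0 < m i) ∧
      ∀ i, (ρ ^ (1 / 4 : ℝ)) (b i) = (m i : ℂ) • b i := by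
  have hc : IsCompactOperator ρ := by
    rw [← CFC.sqrt_mul_sqrt_self ρ hρ]
    exact (isHilbertSchmidt_sqrt hρ hρ_tr).isCompactOperator.clm_comp (CFC.sqrt ρ)
  obtain ⟨ι, b, l, hl⟩ := exists_hilbertBasis_eigenvectors hc (isSymmetric_of_nonneg hρ)
  have hpos : ∀ i, 0 < l i := fun i => eigenvalue_pos_of_isFaithful hρ hρ_tr hρ_faithful b (hl i)
  have hre : ∀ i, 0 < (l i).re ∧ l i = ((l i).re : ℂ) := fun i =>
    ⟨(Complex.pos_iff.1 (hpos i)).1, Complex.ext rfl (by simp [← (Complex.pos_iff.1 (hpos i)).2])⟩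
  refine ⟨ι, b, fun i => √√(l i).re, fun i => Real.sqrt_pos.2 (Real.sqrt_pos.2 (hre i).1),
    fun i => ?_⟩
  have h0 : 0 ≤ ρ ^ (1 / 4 : ℝ) := CFC.rpow_nonneg
  have h1 : (CFC.sqrt ρ * CFC.sqrt ρ) (b i) = ((√(l i).re ^ 2 : ℝ) : ℂ) • b i := by
    rw [CFC.sqrt_mul_sqrt_self ρ hρ, Real.sq_sqrt (hre i).1.le, ← (hre i).2, hl]
  have h2 : (ρ ^ (1 / 4 : ℝ) * ρ ^ (1 / 4 : ℝ)) (b i) = ((√√(l i).re ^ 2 : ℝ) : ℂ) • b i := by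
    rw [rpow_quarter_mul_self hρ, Real.sq_sqrt (Real.sqrt_nonneg _)]
    exact apply_eq_smul_of_mul_self (CFC.sqrt_nonneg ρ) (Real.sqrt_pos.2 (hre i).1) h1
  exact apply_eq_smul_of_mul_self h0 (Real.sqrt_pos.2 (Real.sqrt_pos.2 (hre i).1)) h2

/-! ### One-sided and symmetric norms -/

/-- Right multiplication by a Hilbert-Schmidt operator. -/
noncomputable def S2.mulRight {r : H →L[ℂ] H} (hr : IsHilbertSchmidt r) :
    (H →L[ℂ] H) →ₗ[ℂ] S2 H where
  toFun x := S2.mk (x * r) (hr.mul_left x)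
  map_add' x y := S2.ext (by simp [add_mul])
  map_smul' c x := S2.ext (by simp)

theorem S2.toOp_mulRight {r : H →L[ℂ] H} (hr : IsHilbertSchmidt r) (x : H →L[ℂ] H) :
    S2.toOp H (S2.mulRight hr x) = x * r := rfl

theorem S2.norm_mulRight_star {r : H →L[ℂ] H} (hr : IsHilbertSchmidt r) (hrs : IsSelfAdjoint r)
    (x : H →L[ℂ] H) : ‖S2.mulRight hr (star x)‖ = ‖S2.mk (r * x) (hr.mul_right x)‖ := by
  rw [← S2.norm_mk_adjoint]
  congr 1
  refine S2.ext ?_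
  rw [S2.toOp_mulRight, S2.toOp_mk, ← ContinuousLinearMap.star_eq_adjoint, star_mul, hrs.star_eq]

section Sandwich

variable {R : H →L[ℂ] H} (hR : R.IsSymmetric) (hRR : IsHilbertSchmidt (R * R))
  {ι : Type*} (b : HilbertBasis ι ℂ H) {m : ι → ℝ} (hb : ∀ i, R (b i) = (m i : ℂ) • b i)

include hR hb in
omit [CompleteSpace H] in
-- On `b i` each right-hand `R` is the real scalar `m i`, so both scalars can be collected in the
-- first slot; the left-hand `R` moves across by symmetry.
theorem inner_sandwich_apply (x y : H →L[ℂ] H) (i : ι) :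
    ⟪(R * x * R) (b i), (R * y * R) (b i)⟫_ℂ =
      ⟪(x * (R * R)) (b i), (R * R * y) (b i)⟫_ℂ := by
  have hR' : ∀ u v, ⟪R u, v⟫_ℂ = ⟪u, R v⟫_ℂ := hR
  simp only [mul_apply_eq_comp, hb, map_smul, inner_smul_left, inner_smul_right, hR',
    Complex.conj_ofReal]

include hR hRR hb in
-- For `y = x` the identity above writes `‖R x R bᵢ‖²` as a term of the summable pairing of `x R²`
-- with `R² x`.
theorem isHilbertSchmidt_sandwich (x : H →L[ℂ] H) : IsHilbertSchmidt (R * x * R) := by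
  have h := hasSum_inner (hRR.mul_left x) (hRR.mul_right x) b
  simp only [← inner_sandwich_apply hR b hb, inner_self_eq_norm_sq_to_K] at h
  refine (isHilbertSchmidt_iff b _).2 (Complex.summable_ofReal.1 ?_)
  simpa using h.summable

/-- The map `x ↦ R x R` into the Hilbert-Schmidt operators. -/
noncomputable def S2.sandwich (hmem : ∀ x : H →L[ℂ] H, IsHilbertSchmidt (R * x * R)) :
    (H →L[ℂ] H) →ₗ[ℂ] S2 H where
  toFun x := S2.mk (R * x * R) (hmem x)
  map_add' x y := S2.ext (by simp [add_mul, mul_add])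
  map_smul' c x := S2.ext (by simp)

variable (hmem : ∀ x : H →L[ℂ] H, IsHilbertSchmidt (R * x * R))

theorem S2.toOp_sandwich (x : H →L[ℂ] H) : S2.toOp H (S2.sandwich hmem x) = R * x * R := rfl

include hR hb in
theorem S2.norm_inner_sandwich_le (x y : H →L[ℂ] H) :
    ‖⟪S2.sandwich hmem x, S2.sandwich hmem y⟫_ℂ‖ ≤
      ‖S2.mulRight hRR x‖ * ‖S2.mulRight hRR (star y)‖ := by
  have hs : IsSelfAdjoint (R * R) := by
    have := hR.isSelfAdjoint
    rw [IsSelfAdjoint, star_mul, this.star_eq]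
  have h1 := S2.hasSum_inner (S2.sandwich hmem x) (S2.sandwich hmem y) b
  simp only [S2.toOp_sandwich, inner_sandwich_apply hR b hb] at h1
  have h2 := S2.hasSum_inner (S2.mulRight hRR x) (S2.mk (R * R * y) (hRR.mul_right y)) b
  rw [h1.unique h2, S2.norm_mulRight_star hRR hs]
  exact norm_inner_le_norm _ _

include hR hb in
-- The weight `(m₁ m₂)²` is the geometric mean of the one-sided weights `m₁⁴` and `m₂⁴` of the next
-- two lemmas.
theorem S2.hasSum_norm_sandwich_sq (x : H →L[ℂ] H) :
    HasSum (fun q : ι × ι => (m q.1 * m q.2) ^ 2 * ‖⟪b q.2, x (b q.1)⟫_ℂ‖ ^ 2)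
      (‖S2.sandwich hmem x‖ ^ 2) := by
  have hR' : ∀ u v, ⟪u, R v⟫_ℂ = ⟪R u, v⟫_ℂ := fun u v => (hR u v).symm
  convert! (S2.sandwich hmem x).hasSum_norm_coeff_sq b using 2 with q
  rw [S2.toOp_sandwich, mul_apply_eq_comp, mul_apply_eq_comp, hR', hb, hb, map_smul,
    inner_smul_left, inner_smul_right]
  simp only [norm_mul, Complex.conj_ofReal, Complex.norm_real, mul_pow, Real.norm_eq_abs, sq_abs]
  ring

include hb in
theorem S2.hasSum_norm_mulRight_sq (x : H →L[ℂ] H) :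
    HasSum (fun q : ι × ι => m q.1 ^ 4 * ‖⟪b q.2, x (b q.1)⟫_ℂ‖ ^ 2)
      (‖S2.mulRight hRR x‖ ^ 2) := by
  convert! (S2.mulRight hRR x).hasSum_norm_coeff_sq b using 2 with q
  rw [S2.toOp_mulRight, mul_apply_eq_comp, mul_apply_eq_comp, hb, map_smul, hb, smul_smul,
    map_smul, inner_smul_right]
  simp only [norm_mul, Complex.norm_real, mul_pow, Real.norm_eq_abs, sq_abs]
  ring

include hb in
theorem S2.hasSum_norm_mulRight_star_sq (x : H →L[ℂ] H) :
    HasSum (fun q : ι × ι => m q.2 ^ 4 * ‖⟪b q.2, x (b q.1)⟫_ℂ‖ ^ 2)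
      (‖S2.mulRight hRR (star x)‖ ^ 2) := by
  have h := S2.hasSum_norm_mulRight_sq hRR b hb (star x)
  rw [← (Equiv.prodComm _ _).hasSum_iff] at h
  convert! h using 2 with q
  simp only [Function.comp, Equiv.prodComm_apply, Prod.fst_swap, Prod.snd_swap]
  rw [ContinuousLinearMap.star_eq_adjoint, ContinuousLinearMap.adjoint_inner_right,
    ← inner_conj_symm, RCLike.norm_conj]

/-- The operator supported on finitely many matrix units with the coefficients `c p / (mᵢ mⱼ)`. -/
noncomputable def finiteMatrixOp (m : ι → ℝ) (P : Finset (ι × ι)) :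
    EuclideanSpace ℂ P →ₗ[ℂ] (H →L[ℂ] H) where
  -- This scaling makes the Euclidean norm of `c` the symmetric norm of the operator.
  toFun c := ∑ p : P, (c p * ((m p.1.1 * m p.1.2 : ℝ) : ℂ)⁻¹) •
    InnerProductSpace.rankOne ℂ (b p.1.2) (b p.1.1)
  map_add' c d := by simp [add_mul, add_smul, Finset.sum_add_distrib]
  map_smul' a c := by simp [Finset.smul_sum, smul_smul, mul_assoc]

omit [CompleteSpace H] in
theorem inner_finiteMatrixOp [DecidableEq ι] (P : Finset (ι × ι)) (c : EuclideanSpace ℂ P)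
    (q : ι × ι) :
    ⟪b q.2, finiteMatrixOp b m P c (b q.1)⟫_ℂ =
      if h : q ∈ P then c ⟨q, h⟩ * ((m q.1 * m q.2 : ℝ) : ℂ)⁻¹ else 0 := by
  have h1 : ∀ p : ι × ι, ⟪b q.2, InnerProductSpace.rankOne ℂ (b p.2) (b p.1) (b q.1)⟫_ℂ =
      if p = q then 1 else 0 := fun p => by
    rw [InnerProductSpace.rankOne_apply, inner_smul_right,
      orthonormal_iff_ite.1 b.orthonormal, orthonormal_iff_ite.1 b.orthonormal]
    simp only [Prod.ext_iff, eq_comm (a := q.2)]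
    split_ifs <;> simp_all
  simp only [finiteMatrixOp, LinearMap.coe_mk, AddHom.coe_mk, sum_apply, smul_apply, inner_sum,
    inner_smul_right, h1, mul_ite, mul_one, mul_zero]
  split_ifs with h
  · rw [Finset.sum_eq_single ⟨q, h⟩]
    · simp
    · intro p _ hp
      exact if_neg fun h' => hp (Subtype.ext h')
    · simp
  · exact Finset.sum_eq_zero fun p _ => if_neg fun (h' : p.1 = q) => h (h' ▸ p.2)

omit [CompleteSpace H] in
theorem eq_sum_of_hasSum_finiteMatrixOp {a : ℝ} {P : Finset (ι × ι)} {c : EuclideanSpace ℂ P}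
    {g : ι × ι → ℝ}
    (h : HasSum (fun q => g q * ‖⟪b q.2, finiteMatrixOp b m P c (b q.1)⟫_ℂ‖ ^ 2) a) :
    a = ∑ p : P, g p * (((m p.1.1 * m p.1.2) ^ 2)⁻¹ * ‖c p‖ ^ 2) := by
  classical
  simp only [inner_finiteMatrixOp] at h
  have h1 := hasSum_sum_of_ne_finset_zero (L := .unconditional _) (s := P) (f := fun q : ι × ι =>
    g q * ‖(if h : q ∈ P then c ⟨q, h⟩ * ((m q.1 * m q.2 : ℝ) : ℂ)⁻¹ else 0 : ℂ)‖ ^ 2)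
    fun q hq => by simp [hq]
  rw [h.unique h1, ← Finset.sum_coe_sort]
  refine Finset.sum_congr rfl fun p _ => ?_
  simp only [p.2, dif_pos, norm_mul, norm_inv, Complex.norm_real, mul_pow, inv_pow,
    Real.norm_eq_abs, sq_abs]
  ring

end Sandwich

/-! ### Interpolation and density -/

section Interpolation

variable {R : H →L[ℂ] H} (hR : R.IsSymmetric) (hRR : IsHilbertSchmidt (R * R))
  {ι : Type*} (b : HilbertBasis ι ℂ H) {m : ι → ℝ} (hm : ∀ i, 0 < m i)
  (hb : ∀ i, R (b i) = (m i : ℂ) • b i) (hmem : ∀ x : H →L[ℂ] H, IsHilbertSchmidt (R * x * R))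
  (T : (H →L[ℂ] H) →ₗ[ℂ] (H →L[ℂ] H))
  (hT : ∀ x, ‖S2.mulRight hRR (T x)‖ ≤ ‖S2.mulRight hRR x‖)
  (hT' : ∀ x, ‖S2.mulRight hRR (star (T x))‖ ≤ ‖S2.mulRight hRR (star x)‖)

include hR hm hb hT hT'

/-- In the normalized coordinates the one-sided weights are `m₁⁴ / (m₁ m₂)² = (m₁ / m₂)²` and its
inverse. -/
theorem norm_sandwich_map_finiteMatrixOp_le (P : Finset (ι × ι)) (c : EuclideanSpace ℂ P) :
    ‖S2.sandwich hmem (T (finiteMatrixOp b m P c))‖ ≤ ‖c‖ := by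
  refine norm_map_le_of_weighted_bound (S2.sandwich hmem ∘ₗ T ∘ₗ finiteMatrixOp b m P)
    (fun p => (m p.1.2 / m p.1.1) ^ 2) (fun p => by have := hm p.1.1; have := hm p.1.2; positivity)
    (fun x y => ?_) c
  have h1 := eq_sum_of_hasSum_finiteMatrixOp b
    (S2.hasSum_norm_mulRight_sq hRR b hb (finiteMatrixOp b m P x))
  have h2 := eq_sum_of_hasSum_finiteMatrixOp b
    (S2.hasSum_norm_mulRight_star_sq hRR b hb (finiteMatrixOp b m P y))
  have h3 : ∑ p : P, ((m p.1.2 / m p.1.1) ^ 2)⁻¹ * ‖x p‖ ^ 2 =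
      ‖S2.mulRight hRR (finiteMatrixOp b m P x)‖ ^ 2 := by
    rw [h1]
    refine Finset.sum_congr rfl fun p _ => ?_
    have := hm p.1.1
    have := hm p.1.2
    field_simp
  have h4 : ∑ p : P, (m p.1.2 / m p.1.1) ^ 2 * ‖y p‖ ^ 2 =
      ‖S2.mulRight hRR (star (finiteMatrixOp b m P y))‖ ^ 2 := by
    rw [h2]
    refine Finset.sum_congr rfl fun p _ => ?_
    have := hm p.1.1
    have := hm p.1.2
    field_simp
  rw [h3, h4, ← mul_pow]
  refine pow_le_pow_left₀ (norm_nonneg _) ?_ 2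
  exact (S2.norm_inner_sandwich_le hR hRR b hb hmem _ _).trans
    (mul_le_mul (hT _) (hT' _) (norm_nonneg _) (norm_nonneg _))

/-- A map that contracts both one-sided norms `‖x R²‖₂` and `‖R² x‖₂` contracts the symmetric
norm `‖R x R‖₂`. -/
theorem norm_sandwich_map_le (x : H →L[ℂ] H) :
    ‖S2.sandwich hmem (T x)‖ ≤ ‖S2.sandwich hmem x‖ := by
  classical
  let c : (P : Finset (ι × ι)) → EuclideanSpace ℂ P := fun P =>
    WithLp.toLp 2 fun p => ((m p.1.1 * m p.1.2 : ℝ) : ℂ) * ⟪b p.1.2, x (b p.1.1)⟫_ℂ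
  let y : Finset (ι × ι) → H →L[ℂ] H := fun P => x - finiteMatrixOp b m P (c P)
  have hy : ∀ P q, ‖⟪b q.2, y P (b q.1)⟫_ℂ‖ ^ 2 =
      if q ∈ P then 0 else ‖⟪b q.2, x (b q.1)⟫_ℂ‖ ^ 2 := fun P q => by
    rw [sub_apply, inner_sub_right, inner_finiteMatrixOp]
    split_ifs with h
    · have h0 : ((m q.1 * m q.2 : ℝ) : ℂ) ≠ 0 :=
        Complex.ofReal_ne_zero.2 (mul_pos (hm _) (hm _)).ne'
      simp only [c]
      rw [mul_right_comm, mul_inv_cancel₀ h0, one_mul, sub_self, norm_zero, zero_pow two_ne_zero]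
    · rw [sub_zero]
  have hc : ∀ P, ‖c P‖ ≤ ‖S2.sandwich hmem x‖ := fun P => by
    refine (sq_le_sq₀ (norm_nonneg _) (norm_nonneg _)).1 ?_
    have h1 := sum_le_hasSum P (fun q _ => by positivity)
      (S2.hasSum_norm_sandwich_sq hR b hb hmem x)
    rw [← Finset.sum_coe_sort] at h1
    refine le_trans (le_of_eq ?_) h1
    rw [EuclideanSpace.norm_sq_eq]
    refine Finset.sum_congr rfl fun p _ => ?_
    simp only [c, norm_mul, Complex.norm_real, mul_pow, Real.norm_eq_abs, sq_abs]
  -- Any norm that is a weighted ℓ² norm of the coefficients has, on the remainder `y P`, the tail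
  -- of a convergent series as its square.
  have htail : ∀ {f : (H →L[ℂ] H) → ℝ} {g : ι × ι → ℝ} (_ : ∀ z, 0 ≤ f z)
      (_ : ∀ z, HasSum (fun q => g q * ‖⟪b q.2, z (b q.1)⟫_ℂ‖ ^ 2) (f z ^ 2)),
      Filter.Tendsto (fun P => f (y P)) Filter.atTop (nhds 0) := by
    intro f g hf0 hf
    have h1 : ∀ P, f (y P) = √(f x ^ 2 - ∑ q ∈ P, g q * ‖⟪b q.2, x (b q.1)⟫_ℂ‖ ^ 2) := fun P => by
      have h2 := hf (y P)
      simp only [hy, mul_ite, mul_zero] at h2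
      rw [← h2.unique (hasSum_sub_finset_sum (hf x) P), Real.sqrt_sq (hf0 _)]
    have h3 : Filter.Tendsto (fun P => ∑ q ∈ P, g q * ‖⟪b q.2, x (b q.1)⟫_ℂ‖ ^ 2) Filter.atTop
        (nhds (f x ^ 2)) := hf x
    have h4 := (h3.const_sub (f x ^ 2)).sqrt
    rw [sub_self, Real.sqrt_zero] at h4
    simpa only [h1] using h4
  have hlim := ((htail (fun z => norm_nonneg _) (S2.hasSum_norm_mulRight_sq hRR b hb)).mul
    (htail (fun z => norm_nonneg _) (S2.hasSum_norm_mulRight_star_sq hRR b hb))).sqrt.const_add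
      ‖S2.sandwich hmem x‖
  rw [mul_zero, Real.sqrt_zero, add_zero] at hlim
  refine ge_of_tendsto hlim (Filter.Eventually.of_forall fun P => ?_)
  have hx : x = finiteMatrixOp b m P (c P) + y P := (add_sub_cancel _ _).symm
  conv_lhs => rw [hx, map_add, map_add]
  refine (norm_add_le _ _).trans (add_le_add
    ((norm_sandwich_map_finiteMatrixOp_le hR hRR b hm hb hmem T hT hT' P _).trans (hc P))
    (Real.le_sqrt_of_sq_le ?_))
  -- No symmetric bound for `T` on the remainder is known yet; the geometric mean of the one-sided
  -- norms controls it.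
  have h1 := S2.norm_inner_sandwich_le hR hRR b hb hmem (T (y P)) (T (y P))
  rw [inner_self_eq_norm_sq_to_K, norm_pow, RCLike.norm_ofReal, abs_norm] at h1
  exact h1.trans (mul_le_mul (hT _) (hT' _) (norm_nonneg _) (norm_nonneg _))

omit hT hT' in
-- If `A` is orthogonal to the range, pairing it with `R (R A R) R` gives `‖R A R‖₂² = 0`; as all `m
-- i` are positive, every coefficient of `A` vanishes.
theorem denseRange_sandwich : DenseRange (S2.sandwich hmem) := by
  have hR' : ∀ u v, ⟪u, R v⟫_ℂ = ⟪R u, v⟫_ℂ := fun u v => (hR u v).symm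
  have h : (LinearMap.range (S2.sandwich hmem)).topologicalClosure = ⊤ := by
    rw [Submodule.topologicalClosure_eq_top_iff, eq_bot_iff]
    intro A hA
    have h1 := Submodule.inner_right_of_mem_orthogonal
      (LinearMap.mem_range_self (S2.sandwich hmem) (R * S2.toOp H A * R)) hA
    have h2 := S2.hasSum_inner (S2.sandwich hmem (R * S2.toOp H A * R)) A b
    have h3 : ⟪S2.sandwich hmem (R * S2.toOp H A * R), A⟫_ℂ =
        ((‖S2.sandwich hmem (S2.toOp H A)‖ ^ 2 : ℝ) : ℂ) := by
      refine h2.unique ?_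
      have h4 := S2.hasSum_inner (S2.sandwich hmem (S2.toOp H A))
        (S2.sandwich hmem (S2.toOp H A)) b
      rw [inner_self_eq_norm_sq_to_K] at h4
      convert! h4 using 2 with i
      · simp only [S2.toOp_sandwich, mul_apply_eq_comp, hb, map_smul, inner_smul_left, hR',
          inner_smul_right, Complex.conj_ofReal]
      · simp
    rw [h1] at h3
    have h5 : ‖S2.sandwich hmem (S2.toOp H A)‖ ^ 2 = 0 := by exact_mod_cast h3.symm
    have h6 := S2.hasSum_norm_sandwich_sq hR b hb hmem (S2.toOp H A)
    rw [h5, hasSum_zero_iff_of_nonneg fun q => by positivity] at h6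
    have h7 := A.hasSum_norm_coeff_sq b
    have h8 : ∀ q : ι × ι, ‖⟪b q.2, S2.toOp H A (b q.1)⟫_ℂ‖ ^ 2 = 0 := fun q =>
      (mul_eq_zero.1 (congrFun h6 q)).resolve_left
        (pow_pos (mul_pos (hm _) (hm _)) 2).ne'
    simp only [h8] at h7
    have h9 := h7.unique hasSum_zero
    simpa using h9
  exact Submodule.dense_iff_topologicalClosure_eq_top.2 h

end Interpolation

/-! ### One-sided contraction from the Schwarz inequality, and the conclusion -/

theorem omega_star_mul_self {ρ R : H →L[ℂ] H} (hρ : 0 ≤ ρ) (hρ_tr : IsTraceClass ρ)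
    (hR : R * R * (R * R) = ρ) (hRR : IsHilbertSchmidt (R * R)) {ι : Type*}
    (b : HilbertBasis ι ℂ H) {m : ι → ℝ} (hb : ∀ i, R (b i) = (m i : ℂ) • b i)
    (x : H →L[ℂ] H) :
    omega ρ (star x * x) = ((‖S2.mulRight hRR x‖ ^ 2 : ℝ) : ℂ) := by
  have hρ' : ∀ u v, ⟪u, ρ v⟫_ℂ = ⟪ρ u, v⟫_ℂ := fun u v => (isSymmetric_of_nonneg hρ u v).symm
  refine (hasSum_omega hρ hρ_tr (star x * x) b).unique ?_
  have h := S2.hasSum_inner (S2.mulRight hRR x) (S2.mulRight hRR x) b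
  rw [inner_self_eq_norm_sq_to_K] at h
  convert! h using 2 with i
  · rw [mul_apply_eq_comp, hρ', ← hR, mul_apply_eq_comp (star x), ContinuousLinearMap.star_eq_adjoint,
      ContinuousLinearMap.adjoint_inner_right]
    simp only [S2.toOp_mulRight, mul_apply_eq_comp, hb, map_smul, inner_smul_left,
      inner_smul_right, Complex.conj_ofReal]
  · simp

/-- This is the chain `ω(T(x)* T(x)) ≤ ω(T(x* x)) ≤ ω(x* x)`; the first step uses that `ω` is
nonnegative on `s* s`. -/
theorem norm_mulRight_map_le {ρ R : H →L[ℂ] H} (hρ : 0 ≤ ρ) (hρ_tr : IsTraceClass ρ)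
    (hR : R * R * (R * R) = ρ) (hRR : IsHilbertSchmidt (R * R)) {ι : Type*}
    (b : HilbertBasis ι ℂ H) {m : ι → ℝ} (hb : ∀ i, R (b i) = (m i : ℂ) • b i)
    {T : (H →L[ℂ] H) →L[ℂ] (H →L[ℂ] H)} (hT : IsSchwarzMap T)
    (hT_sub : IsSubinvariant (omega ρ) T) (x : H →L[ℂ] H) :
    ‖S2.mulRight hRR (T x)‖ ≤ ‖S2.mulRight hRR x‖ := by
  have hω := omega_star_mul_self hρ hρ_tr hR hRR b hb
  obtain ⟨s, hs⟩ := CStarAlgebra.nonneg_iff_eq_star_mul_self.1 (sub_nonneg.2 (hT x))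
  have h1 : 0 ≤ omega ρ (T (star x * x) - star (T x) * T x) := by
    rw [hs, hω]
    exact Complex.zero_le_real.2 (sq_nonneg _)
  have h2 : omega ρ (T (star x * x) - star (T x) * T x) =
      omega ρ (T (star x * x)) - omega ρ (star (T x) * T x) := by
    refine (hasSum_omega hρ hρ_tr _ b).unique ?_
    convert! (hasSum_omega hρ hρ_tr (T (star x * x)) b).sub
      (hasSum_omega hρ hρ_tr (star (T x) * T x) b) using 2 with i
    rw [mul_sub, sub_apply, inner_sub_right]
  rw [h2, sub_nonneg] at h1
  have h3 := h1.trans (hT_sub _ (star_mul_self_nonneg x))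
  rw [hω, hω, Complex.real_le_real] at h3
  exact (sq_le_sq₀ (norm_nonneg _) (norm_nonneg _)).1 h3

end SchwarzMaps

theorem mainTheorem3 {H : Type*} [NormedAddCommGroup H] [InnerProductSpace ℂ H] [CompleteSpace H]
    (ρ : H →L[ℂ] H) (hρ : 0 ≤ ρ) (hρ_tr : IsTraceClass ρ) (hρ_faithful : IsFaithful (omega ρ))
    (T : (H →L[ℂ] H) →L[ℂ] (H →L[ℂ] H)) (hT : IsSchwarzMap T)
    (hT_sub : IsSubinvariant (omega ρ) T) :
    ∃ hmem : ∀ x : H →L[ℂ] H, IsHilbertSchmidt (iRho ρ x),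
      ∃ S : S2 H →L[ℂ] S2 H, ‖S‖ ≤ 1 ∧
        ∀ x : H →L[ℂ] H,
          S (S2.mk (iRho ρ x) (hmem x)) = S2.mk (iRho ρ (T x)) (hmem (T x)) := by
  obtain ⟨ι, b, m, hm, hb⟩ := exists_hilbertBasis_rpow_quarter hρ hρ_tr hρ_faithful
  have hroot := rpow_quarter_mul_self hρ
  have hR : (ρ ^ (1 / 4 : ℝ)).IsSymmetric := isSymmetric_of_nonneg CFC.rpow_nonneg
  unfold iRho
  -- Only the symmetry of `R`, its eigenbasis and `R² = ρ^{1/2}` matter from here on.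
  generalize ρ ^ (1 / 4 : ℝ) = R at hb hroot hR ⊢
  have hRR : IsHilbertSchmidt (R * R) := hroot ▸ isHilbertSchmidt_sqrt hρ hρ_tr
  have hR4 : R * R * (R * R) = ρ := by rw [hroot, CFC.sqrt_mul_sqrt_self ρ hρ]
  have hmem := isHilbertSchmidt_sandwich hR hRR b hb
  have h1 := norm_mulRight_map_le hρ hρ_tr hR4 hRR b hb hT hT_sub
  have h2 : ∀ x, ‖S2.mulRight hRR (star (T x))‖ ≤ ‖S2.mulRight hRR (star x)‖ := fun x => by
    rw [← hT.map_star]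
    exact h1 _
  have h3 : ∀ x, ‖(S2.sandwich hmem ∘ₗ (T : (H →L[ℂ] H) →ₗ[ℂ] (H →L[ℂ] H))) x‖ ≤
      1 * ‖S2.sandwich hmem x‖ := fun x => by
    rw [one_mul]
    exact norm_sandwich_map_le hR hRR b hm hb hmem T h1 h2 x
  have hd := denseRange_sandwich hR b hm hb hmem
  exact ⟨hmem, LinearMap.extendOfNorm _ (S2.sandwich hmem),
    LinearMap.opNorm_extendOfNorm_le hd zero_le_one h3,
    fun x => LinearMap.extendOfNorm_eq hd ⟨1, h3⟩ x⟩
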